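/- **Setting.** Consider the plant $\dot x=f(x)+Bu+Ed$ with $x\in\mathbb R^n$, $u\in\mathbb R^m$, $d\in\mathbb R^q$. Assume that $f(x)=AZ(x)$ for all $x$, where $A\in\mathbb R^{n\times s}$ and $Z(x)=\begin{bmatrix}x\\Q(x)\end{bmatrix}\in\mathbb R^s$ with $Q:\mathbb R^n\to\mathbb R^{s-n}$ continuously differentiable. Let $R_Q\in\mathbb R^{n\times\tau}$ satisfy $\frac{\partial Q}{\partial x}(x)^\top\frac{\partial Q}{\partial x}(x)\preceq R_QR_Q^\top$ for all $x\in\mathbb R^n$. Let $\delta>0$, and call a signal $d:\mathbb R\to\mathbb R^q$ admissible if it is continuous and $|d(t)|\le\delta$ for all $t\in\mathbb R$ (here $|\cdot|$ is the 2-norm). In an experiment on the plant, $x_i=x(t_i)$, $u_i=u(t_i)$ and $\dot x_i=\dot x(t_i)$ are recorded at times $0\le t_0<\dots<t_{T-1}$, where $T\ge 1$. The (unknown) disturbance samples $d_i=d(t_i)$ satisfy $|d_i|\le\delta$, so that $\dot x_i=f(x_i)+Bu_i+Ed_i$. Put $U_0=[u_0\,\cdots\,u_{T-1}]$, $X_1=[\dot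 x_0\,\cdots\,\dot x_{T-1}]$ and $Z_0=[Z(x_0)\,\cdots\,Z(x_{T-1})]$. Let the symmetric matrix $P\in\mathbb R^{n\times n}$, $Y_1\in\mathbb R^{T\times n}$, $G_2\in\mathbb R^{T\times(s-n)}$, $\alpha>0$ and $\mu>0$ satisfy, with $\Delta=\delta\sqrt T\,I_q$, $$P\succ0,\qquad Z_0Y_1=\begin{bmatrix}P\\0\end{bmatrix},\qquad Z_0G_2=\begin{bmatrix}0\\I_{s-n}\end{bmatrix},$$ $$\begin{bmatrix}X_1Y_1+(X_1Y_1)^\top+\alpha I_n+\mu E\Delta\Delta^\top E^\top&\star&\star&\star\\ G_2^\top X_1^\top&-I_{s-n}&\star&\star\\ R_Q^\top P&0&-I_\tau&\star\\ Y_1&G_2&0&-\mu I_T\end{bmatrix}\preceq0,$$ where $\star$ denotes the blocks determined by symmetry. Let $K=U_0\begin{bmatrix}Y_1P^{-1}&G_2\end{bmatrix}$. **Claim.** For every admissible $d$, the closed-loop system $\dot x=(A+BK)Z(x)+Ed(t)$ is convergent, that is: 1. for all $t_0\in\mathbb R$ and $x(t_0)\in\mathbb R^n$, its solutions are defined for all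 $t\ge t_0$; 2. there is a unique solution $x_*$ that is defined and bounded on all of $\mathbb R$; 3. $x_*$ is globally uniformly exponentially stable: there are $c,\lambda>0$ such that $|x(t)-x_*(t)|\le c\,e^{-\lambda(t-t_0)}|x(t_0)-x_*(t_0)|$ for all $t_0\in\mathbb R$, all $t\ge t_0$ and every solution $x$ on $[t_0,\infty)$. If $d$ is periodic with period $\theta>0$, then so is $x_*$. If $d$ is constant, then $x_*$ is constant. Finally, for every admissible $d$ there exist a $\mathcal{KL}$ function $\hat\beta$ and a $\mathcal K_\infty$ function $\hat\gamma$ such that, for every continuous bounded input $w:[0,\infty)\to\mathbb R^n$, the solutions of $\dot x=(A+BK)Z(x)+Ed(t)+w(t)$ from any $x(0)\in\mathbb R^n$ are defined for all $t\ge0$ and satisfy $$|x(t)-x_*(t)|\le\hat\beta\bigl(|x(0)-x_*(0)|,t\bigr)+\hat\gamma\Bigl(\sup_{0\le\sigma\le t}|w(\sigma)|\Bigr)\qquad\text{for all }t\ge0.$$ -/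

import Mathlib

open Set Filter Topology
open scoped Matrix

noncomputable section

namespace DataControl

/-- `ℝᵏ` with the 2-norm. -/
abbrev Vec (ι : Type) [Fintype ι] : Type := EuclideanSpace ℝ ι

/-- The matrix-vector product `M v`, with values in the Euclidean space. -/
def mulV {ι κ : Type} [Fintype ι] [Fintype κ] (M : Matrix ι κ ℝ) (v : Vec κ) : Vec ι :=
  WithLp.toLp 2 (M *ᵥ v.ofLp)

/-! ### Systems `ẋ = v(t, x)` -/

section Systems

variable {n : ℕ}

/-- From the initial time `t₀` on, the system `ẋ = v(t, x)` has, for every initial value, a solution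
defined on `[t₀, ∞)`, and no solution escapes in finite time: each solution on some `[t₀, b)` is
the restriction of a solution on `[t₀, ∞)`. -/
def ForwardCompleteFrom (v : ℝ → Vec (Fin n) → Vec (Fin n)) (t₀ : ℝ) : Prop :=
  ∀ x₀ : Vec (Fin n),
    (∃ x : ℝ → Vec (Fin n), x t₀ = x₀ ∧ IsIntegralCurveOn x v (Ici t₀)) ∧
    ∀ b : ℝ, t₀ < b → ∀ y : ℝ → Vec (Fin n), y t₀ = x₀ → IsIntegralCurveOn y v (Ico t₀ b) →
      ∃ x : ℝ → Vec (Fin n), IsIntegralCurveOn x v (Ici t₀) ∧ EqOn x y (Ico t₀ b)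

/-- `x` is a solution of `ẋ = v(t, x)` that is defined and bounded on all of `ℝ`. -/
def IsBoundedSolution (v : ℝ → Vec (Fin n) → Vec (Fin n)) (x : ℝ → Vec (Fin n)) : Prop :=
  IsIntegralCurve x v ∧ ∃ C : ℝ, ∀ t : ℝ, ‖x t‖ ≤ C

/-- The solution `xs` is globally uniformly exponentially stable: overshoot and rate
depend neither on the initial time nor on the initial value. -/
def IsGUES (v : ℝ → Vec (Fin n) → Vec (Fin n)) (xs : ℝ → Vec (Fin n)) : Prop :=
  ∃ c > (0 : ℝ), ∃ lam > (0 : ℝ), ∀ t₀ : ℝ, ∀ x : ℝ → Vec (Fin n),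
    IsIntegralCurveOn x v (Ici t₀) →
      ∀ t : ℝ, t₀ ≤ t → ‖x t - xs t‖ ≤ c * Real.exp (-lam * (t - t₀)) * ‖x t₀ - xs t₀‖

/-- Convergent systems. -/
def IsConvergent (v : ℝ → Vec (Fin n) → Vec (Fin n)) : Prop :=
  (∀ t₀ : ℝ, ForwardCompleteFrom v t₀) ∧
  ∃ xs : ℝ → Vec (Fin n),
    (IsBoundedSolution v xs ∧ ∀ y : ℝ → Vec (Fin n), IsBoundedSolution v y → y = xs) ∧
    IsGUES v xs

end Systems

/-! ### Comparison functions (on `[0, ∞)`) -/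

/-- Class `𝒦`. -/
def IsClassK (g : ℝ → ℝ) : Prop :=
  g 0 = 0 ∧ ContinuousOn g (Ici 0) ∧ StrictMonoOn g (Ici 0)

/-- Class `𝒦_∞`. -/
def IsClassKInfty (g : ℝ → ℝ) : Prop :=
  IsClassK g ∧ Tendsto g atTop atTop

/-- Class `𝒦ℒ`. -/
def IsClassKL (b : ℝ → ℝ → ℝ) : Prop :=
  ContinuousOn (Function.uncurry b) (Ici 0 ×ˢ Ici 0) ∧
  (∀ t : ℝ, 0 ≤ t → IsClassK (fun r => b r t)) ∧
  (∀ r : ℝ, 0 ≤ r → AntitoneOn (b r) (Ici 0) ∧ Tendsto (b r) atTop (𝓝 0))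

/-! ### The plant, the data and the semidefinite program -/

section Plant

variable {n m r q τ T : ℕ}

/-- The dictionary `Z(x) = [x; Q(x)]`, where `Q` has `r = s - n` components. -/
def dict (Q : Vec (Fin n) → Vec (Fin r)) (x : Vec (Fin n)) : Vec (Fin n ⊕ Fin r) :=
  WithLp.toLp 2 (Sum.elim x.ofLp (Q x).ofLp)

/-- The Jacobian matrix `∂Q/∂x (x)`. -/
def jacobian (Q : Vec (Fin n) → Vec (Fin r)) (x : Vec (Fin n)) : Matrix (Fin r) (Fin n) ℝ :=
  Matrix.of fun i j => fderiv ℝ Q x (EuclideanSpace.single j 1) i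

/-- An experiment on the plant `ẋ = f(x) + B u + E d`: signals `x`, `u`, `d`, sampled together with
`ẋ` at the times `0 ≤ t_0 < … < t_{T-1}`, where the signals obey the plant equation at the sampling
times. (The derivative is only asked for from the right, so that the initial time and switching
times of the input may be sampled.) -/
structure Experiment (f : Vec (Fin n) → Vec (Fin n)) (B : Matrix (Fin n) (Fin m) ℝ)
    (E : Matrix (Fin n) (Fin q) ℝ) (T : ℕ) where
  time : Fin T → ℝ
  time_nonneg : ∀ i, 0 ≤ time i
  time_strictMono : StrictMono time
  state : ℝ → Vec (Fin n)
  input : ℝ → Vec (Fin m)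
  disturbance : ℝ → Vec (Fin q)
  velocity : Fin T → Vec (Fin n)
  hasDeriv : ∀ i, HasDerivWithinAt state (velocity i) (Ici (time i)) (time i)
  plant : ∀ i, velocity i =
    f (state (time i)) + mulV B (input (time i)) + mulV E (disturbance (time i))

namespace Experiment

variable {f : Vec (Fin n) → Vec (Fin n)} {B : Matrix (Fin n) (Fin m) ℝ}
  {E : Matrix (Fin n) (Fin q) ℝ}

/-- `U₀ = [u_0 … u_{T-1}]`. -/
def U0 (e : Experiment f B E T) : Matrix (Fin m) (Fin T) ℝ :=
  Matrix.of fun i k => e.input (e.time k) i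

/-- `X₁ = [ẋ_0 … ẋ_{T-1}]`. -/
def X1 (e : Experiment f B E T) : Matrix (Fin n) (Fin T) ℝ :=
  Matrix.of fun i k => e.velocity k i

/-- `Z₀ = [Z(x_0) … Z(x_{T-1})]`. -/
def Z0 (e : Experiment f B E T) (Q : Vec (Fin n) → Vec (Fin r)) :
    Matrix (Fin n ⊕ Fin r) (Fin T) ℝ :=
  Matrix.of fun i k => dict Q (e.state (e.time k)) i

end Experiment

/-- The symmetric block matrix of the linear matrix inequality, with block rows and columns of sizes
`n`, `r`, `τ`, `T`:
```
[ X₁Y₁ + (X₁Y₁)ᵀ + αI + μEΔΔᵀEᵀ    ⋆     ⋆     ⋆  ]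
[ G₂ᵀX₁ᵀ                          -I     ⋆     ⋆  ]
[ R_QᵀP                            0    -I     ⋆  ]
[ Y₁                               G₂    0   -μI  ]
``` -/
def lmiMatrix (X₁ : Matrix (Fin n) (Fin T) ℝ) (E : Matrix (Fin n) (Fin q) ℝ)
    (Δ : Matrix (Fin q) (Fin q) ℝ) (R : Matrix (Fin n) (Fin τ) ℝ)
    (P : Matrix (Fin n) (Fin n) ℝ) (Y₁ : Matrix (Fin T) (Fin n) ℝ)
    (G₂ : Matrix (Fin T) (Fin r) ℝ) (α μ : ℝ) :
    Matrix ((Fin n ⊕ Fin r) ⊕ (Fin τ ⊕ Fin T)) ((Fin n ⊕ Fin r) ⊕ (Fin τ ⊕ Fin T)) ℝ :=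
  Matrix.fromBlocks
    (Matrix.fromBlocks
      (X₁ * Y₁ + (X₁ * Y₁)ᵀ + α • (1 : Matrix (Fin n) (Fin n) ℝ) + μ • (E * Δ * Δᵀ * Eᵀ))
      (G₂ᵀ * X₁ᵀ)ᵀ
      (G₂ᵀ * X₁ᵀ)
      (-1))
    (Matrix.fromBlocks (Rᵀ * P)ᵀ Y₁ᵀ 0 G₂ᵀ)
    (Matrix.fromBlocks (Rᵀ * P) 0 Y₁ G₂)
    (Matrix.fromBlocks (-1) 0 0 (-(μ • (1 : Matrix (Fin T) (Fin T) ℝ))))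

/-- `(P, Y₁, G₂, α, μ)` is a feasible point of the semidefinite program. -/
structure IsFeasible (X₁ : Matrix (Fin n) (Fin T) ℝ) (Z₀ : Matrix (Fin n ⊕ Fin r) (Fin T) ℝ)
    (E : Matrix (Fin n) (Fin q) ℝ) (Δ : Matrix (Fin q) (Fin q) ℝ) (R : Matrix (Fin n) (Fin τ) ℝ)
    (P : Matrix (Fin n) (Fin n) ℝ) (Y₁ : Matrix (Fin T) (Fin n) ℝ)
    (G₂ : Matrix (Fin T) (Fin r) ℝ) (α μ : ℝ) : Prop where
  alpha_pos : 0 < α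
  mu_pos : 0 < μ
  posDef : P.PosDef
  eq_left : Z₀ * Y₁ = Matrix.fromRows P 0
  lmi : (-(lmiMatrix X₁ E Δ R P Y₁ G₂ α μ)).PosSemidef
  eq_right : Z₀ * G₂ = Matrix.fromRows 0 1

/-- The gain `K = U₀ [Y₁P⁻¹  G₂]`. -/
def gain (U₀ : Matrix (Fin m) (Fin T) ℝ) (P : Matrix (Fin n) (Fin n) ℝ)
    (Y₁ : Matrix (Fin T) (Fin n) ℝ) (G₂ : Matrix (Fin T) (Fin r) ℝ) :
    Matrix (Fin m) (Fin n ⊕ Fin r) ℝ :=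
  U₀ * Matrix.fromCols (Y₁ * P⁻¹) G₂

/-- The right-hand side of the closed loop `ẋ = (A + BK) Z(x) + E d(t)`. -/
def closedLoop (A : Matrix (Fin n) (Fin n ⊕ Fin r) ℝ) (B : Matrix (Fin n) (Fin m) ℝ)
    (E : Matrix (Fin n) (Fin q) ℝ) (Q : Vec (Fin n) → Vec (Fin r))
    (K : Matrix (Fin m) (Fin n ⊕ Fin r) ℝ) (d : ℝ → Vec (Fin q)) :
    ℝ → Vec (Fin n) → Vec (Fin n) :=
  fun t x => mulV (A + B * K) (dict Q x) + mulV E (d t)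

end Plant

end DataControl

end

open DataControl

/-! The closed loop is contracting in the metric `P⁻¹`; convergence follows from this and global
Lipschitz continuity.

The equality constraints make `[Y₁P⁻¹ G₂]` a right inverse of `Z₀`, so the data equation `X₁ = A Z₀
+ B U₀ + E D₀` turns the unknown `A + BK` into `(X₁ - E D₀)[Y₁P⁻¹ G₂]` (`add_mul_gain_eq`). Of the
disturbance samples `D₀` only `D₀D₀ᵀ ⪯ δ²T I` is known; that is enough, since the matrix inequality
absorbs every such `D₀` and every slope of `Q` allowed by `R` (`two_mul_dotProduct_le_of_lmi`).
Integrated along the segment from `y` to `x`, the infinitesimal estimate says that `⟨P⁻¹(x - y), x -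
y⟩` is a quadratic Lyapunov function for differences of trajectories
(`dissipative_of_matrix_bound`).

Hence two trajectories, one of them perturbed by an input, approach each other exponentially up to a
multiple of the size of the input (`exists_isIncrementallyStable`). All claims are instances of this
estimate: the bounded solution is the limit of solutions started at `0` at times `-k → -∞`;
uniqueness compares two bounded solutions from the remote past; periodicity and constancy follow
from uniqueness; the input bound is the estimate itself. -/

namespace DataControl

/-! ### Global existence: a Picard iteration in an exponentially weighted norm -/

section Existence

variable {F : Type*} [NormedAddCommGroup F] [NormedSpace ℝ F]

lemma integral_exp_mul_le {l T : ℝ} (hl : 0 < l) :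
    ∫ s in (0 : ℝ)..T, Real.exp (l * s) ≤ l⁻¹ * Real.exp (l * T) := by
  rw [intervalIntegral.integral_comp_mul_left (fun s => Real.exp s) hl.ne', integral_exp, smul_eq_mul]
  have := Real.exp_pos (l * 0)
  gcongr
  linarith

/-- The Picard operator with initial time `0`, in the variable `z t = exp (-l * t) • x t`. -/
noncomputable def weightedPicard (v : ℝ → F → F) (x₀ : F) (l : ℝ) (z : ℝ → F) (t : ℝ) : F :=
  Real.exp (-(l * max t 0)) • (x₀ + ∫ s in (0 : ℝ)..max t 0, v s (Real.exp (l * s) • z s))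

variable {v : ℝ → F → F} {C M l : ℝ}

lemma continuous_weighted_integrand (hv : Continuous (Function.uncurry v)) {z : ℝ → F}
    (hz : Continuous z) : Continuous fun s => v s (Real.exp (l * s) • z s) :=
  hv.comp (continuous_id.prodMk (by fun_prop : Continuous fun s => Real.exp (l * s) • z s))

lemma continuous_weightedPicard [CompleteSpace F] (hv : Continuous (Function.uncurry v)) (x₀ : F)
    {z : ℝ → F} (hz : Continuous z) : Continuous (weightedPicard v x₀ l z) := by
  have h := continuous_weighted_integrand (l := l) hv hz
  have h' : Continuous fun t => ∫ s in (0 : ℝ)..t, v s (Real.exp (l * s) • z s) :=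
    intervalIntegral.continuous_primitive (fun a b => h.intervalIntegrable a b) 0
  have h2 := h'.comp (by fun_prop : Continuous fun t : ℝ => max t 0)
  unfold weightedPicard
  exact (by fun_prop : Continuous fun t => Real.exp (-(l * max t 0))).smul
    (continuous_const.add h2)

/-- Undoing the weight bounds the difference of the integrands by `C D exp (l s)`. Its integral is
at most `C D exp (l T) / l`, and the prefactor `exp (-l T)` cancels the growth. A large `l` thus
gives a contraction without any restriction on the time interval. -/
lemma norm_weightedPicard_sub_le (hv : Continuous (Function.uncurry v)) (hC : 0 ≤ C)
    (hlip : ∀ t x y, ‖v t x - v t y‖ ≤ C * ‖x - y‖) (x₀ : F) (hl : 0 < l) {z z' : ℝ → F}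
    (hz : Continuous z) (hz' : Continuous z') {D : ℝ} (hD : ∀ s, ‖z s - z' s‖ ≤ D) (t : ℝ) :
    ‖weightedPicard v x₀ l z t - weightedPicard v x₀ l z' t‖ ≤ C * l⁻¹ * D := by
  have hD0 : 0 ≤ D := (norm_nonneg _).trans (hD 0)
  have h := continuous_weighted_integrand (l := l) hv hz
  have h' := continuous_weighted_integrand (l := l) hv hz'
  have hT : (0 : ℝ) ≤ max t 0 := le_max_right _ _
  unfold weightedPicard
  generalize max t 0 = T at hT
  rw [← smul_sub, add_sub_add_left_eq_sub,
    ← intervalIntegral.integral_sub (h.intervalIntegrable _ _) (h'.intervalIntegrable _ _),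
    norm_smul, Real.norm_eq_abs, abs_of_pos (Real.exp_pos _)]
  have key : ‖∫ s in (0 : ℝ)..T, v s (Real.exp (l * s) • z s) - v s (Real.exp (l * s) • z' s)‖
      ≤ ∫ s in (0 : ℝ)..T, C * D * Real.exp (l * s) := by
    refine intervalIntegral.norm_integral_le_of_norm_le hT (.of_forall fun s _ => ?_)
      (by apply Continuous.intervalIntegrable; fun_prop)
    refine (hlip _ _ _).trans ?_
    rw [← smul_sub, norm_smul, Real.norm_eq_abs, abs_of_pos (Real.exp_pos _)]
    calc _ ≤ C * (Real.exp (l * s) * D) := by gcongr; exact hD s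
      _ = _ := by ring
  rw [intervalIntegral.integral_const_mul] at key
  calc _ ≤ Real.exp (-(l * T)) * (C * D * (l⁻¹ * Real.exp (l * T))) := by
        gcongr
        refine key.trans ?_
        gcongr
        exact integral_exp_mul_le hl
    _ = C * l⁻¹ * D * (Real.exp (-(l * T)) * Real.exp (l * T)) := by ring
    _ = _ := by rw [← Real.exp_add]; simp

/-- Together with the previous estimate this shows that the operator preserves boundedness. For `s ≥
0` the constant `M` is dominated by `M exp (l s)`, so the same integral bound applies. -/
lemma norm_weightedPicard_zero_le (hM : ∀ t, ‖v t 0‖ ≤ M) (x₀ : F) (hl : 0 < l) (t : ℝ) :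
    ‖weightedPicard v x₀ l 0 t‖ ≤ ‖x₀‖ + M * l⁻¹ := by
  have hM0 : 0 ≤ M := (norm_nonneg _).trans (hM 0)
  have hT : (0 : ℝ) ≤ max t 0 := le_max_right _ _
  unfold weightedPicard
  generalize max t 0 = T at hT
  rw [norm_smul, Real.norm_eq_abs, abs_of_pos (Real.exp_pos _)]
  have key : ‖∫ s in (0 : ℝ)..T, v s (Real.exp (l * s) • (0 : ℝ → F) s)‖
      ≤ ∫ s in (0 : ℝ)..T, M * Real.exp (l * s) := by
    refine intervalIntegral.norm_integral_le_of_norm_le hT (.of_forall fun s hs => ?_)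
      (by apply Continuous.intervalIntegrable; fun_prop)
    have : 1 ≤ Real.exp (l * s) := Real.one_le_exp (mul_nonneg hl.le hs.1.le)
    simp only [Pi.zero_apply, smul_zero]
    exact (hM s).trans (le_mul_of_one_le_right hM0 this)
  rw [intervalIntegral.integral_const_mul] at key
  have h1 : Real.exp (-(l * T)) ≤ 1 := Real.exp_le_one_iff.2 (by nlinarith)
  calc _ ≤ Real.exp (-(l * T)) * (‖x₀‖ + M * (l⁻¹ * Real.exp (l * T))) := by
        gcongr
        refine (norm_add_le _ _).trans ?_
        gcongr
        refine key.trans ?_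
        gcongr
        exact integral_exp_mul_le hl
    _ = Real.exp (-(l * T)) * ‖x₀‖ + M * l⁻¹ * (Real.exp (-(l * T)) * Real.exp (l * T)) := by ring
    _ = Real.exp (-(l * T)) * ‖x₀‖ + M * l⁻¹ := by rw [← Real.exp_add]; simp
    _ ≤ _ := by gcongr; exact mul_le_of_le_one_left (norm_nonneg _) h1

/-- Global forward existence for a globally Lipschitz vector field that is bounded at the origin,
with initial time `0`. -/
lemma exists_isIntegralCurveOn_Ici_zero [CompleteSpace F] (hv : Continuous (Function.uncurry v))
    (hC : 0 ≤ C) (hlip : ∀ t x y, ‖v t x - v t y‖ ≤ C * ‖x - y‖) (hM : ∀ t, ‖v t 0‖ ≤ M)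
    (x₀ : F) : ∃ x : ℝ → F, x 0 = x₀ ∧ IsIntegralCurveOn x v (Ici 0) := by
  -- The contraction factor is `C / l ≤ 1 / 2`; the summand `1` keeps `l` positive when `C = 0`.
  let l : ℝ := 2 * (C + 1)
  have hl : 0 < l := by positivity
  let Φ : BoundedContinuousFunction ℝ F → BoundedContinuousFunction ℝ F := fun z =>
    BoundedContinuousFunction.ofNormedAddCommGroup (weightedPicard v x₀ l z)
      (continuous_weightedPicard hv x₀ z.continuous) (C * l⁻¹ * ‖z‖ + (‖x₀‖ + M * l⁻¹)) fun t => by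
        have h1 := norm_weightedPicard_sub_le hv hC hlip x₀ hl z.continuous
          (continuous_zero : Continuous (0 : ℝ → F)) (D := ‖z‖)
          (fun s => by simpa using z.norm_coe_le_norm s) t
        have h2 := norm_weightedPicard_zero_le hM x₀ hl t
        calc _ = ‖(weightedPicard v x₀ l z t - weightedPicard v x₀ l 0 t)
              + weightedPicard v x₀ l 0 t‖ := by rw [sub_add_cancel]
          _ ≤ _ := (norm_add_le _ _).trans (add_le_add h1 h2)
  have hΦ : ContractingWith (1 / 2) Φ := by
    refine ⟨by rw [← NNReal.coe_lt_coe]; norm_num, LipschitzWith.of_dist_le_mul fun z z' => ?_⟩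
    refine (BoundedContinuousFunction.dist_le (by positivity)).2 fun t => ?_
    have h1 := norm_weightedPicard_sub_le hv hC hlip x₀ hl z.continuous z'.continuous
      (D := dist z z') (fun s => by
        rw [← dist_eq_norm]; exact BoundedContinuousFunction.dist_coe_le_dist s) t
    rw [dist_eq_norm]
    refine h1.trans ?_
    gcongr
    simp only [l]
    push_cast
    rw [← div_eq_mul_inv, div_le_div_iff₀ (by positivity) (by norm_num)]
    linarith
  let z := hΦ.fixedPoint
  have hz : ∀ t, weightedPicard v x₀ l z t = z t := fun t =>
    congrArg (fun f : BoundedContinuousFunction ℝ F => f t) hΦ.fixedPoint_isFixedPt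
  have hcont := continuous_weighted_integrand (l := l) hv z.continuous
  have hx : ∀ t, 0 ≤ t → Real.exp (l * t) • z t =
      x₀ + ∫ s in (0 : ℝ)..t, v s (Real.exp (l * s) • z s) := fun t ht => by
    rw [← hz t, weightedPicard, max_eq_left ht, smul_smul, ← Real.exp_add]
    simp
  refine ⟨fun t => Real.exp (l * t) • z t, (hx 0 le_rfl).trans (by simp), fun t ht => ?_⟩
  have hd : HasDerivAt (fun t => x₀ + ∫ s in (0 : ℝ)..t, v s (Real.exp (l * s) • z s))
      (v t (Real.exp (l * t) • z t)) t :=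
    (intervalIntegral.integral_hasDerivAt_right (hcont.intervalIntegrable _ _)
      hcont.stronglyMeasurable.stronglyMeasurableAtFilter hcont.continuousAt).const_add _
  exact hd.hasDerivWithinAt.congr (fun s hs => hx s hs) (hx t ht)

/-- Global forward existence for a globally Lipschitz vector field that is bounded at the origin. -/
lemma exists_isIntegralCurveOn_Ici [CompleteSpace F] (hv : Continuous (Function.uncurry v))
    (hC : 0 ≤ C) (hlip : ∀ t x y, ‖v t x - v t y‖ ≤ C * ‖x - y‖) (hM : ∀ t, ‖v t 0‖ ≤ M)
    (t₀ : ℝ) (x₀ : F) : ∃ x : ℝ → F, x t₀ = x₀ ∧ IsIntegralCurveOn x v (Ici t₀) := by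
  obtain ⟨x, hx0, hx⟩ := exists_isIntegralCurveOn_Ici_zero (v := fun t => v (t + t₀))
    (hv.comp (by fun_prop : Continuous fun p : ℝ × F => (p.1 + t₀, p.2))) hC
    (fun t => hlip _) (fun t => hM _) x₀
  refine ⟨fun t => x (t - t₀), by simpa using hx0, fun t ht => ?_⟩
  have h := hx (t - t₀) (mem_Ici.2 (sub_nonneg.2 ht))
  have h2 := HasDerivWithinAt.scomp t h ((hasDerivAt_id t).sub_const t₀).hasDerivWithinAt
    (t' := Ici 0) (s := Ici t₀) (fun s hs => mem_Ici.2 (sub_nonneg.2 hs))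
  simpa [Function.comp_def] using h2

end Existence

/-! ### Quadratic Lyapunov functions and incremental stability -/

section Dissipative

open scoped RealInnerProductSpace

variable {F : Type*} [NormedAddCommGroup F] [InnerProductSpace ℝ F]

/-- Two trajectories of `ẋ = v(t, x)`, the first one perturbed by an input of size at most `W`,
approach each other exponentially up to an error proportional to `W`. -/
def IsIncrementallyStable (v : ℝ → F → F) (c l g : ℝ) : Prop :=
  ∀ a b : ℝ, a ≤ b → ∀ x y w : ℝ → F, ∀ W : ℝ,
    IsIntegralCurveOn x (fun t x => v t x + w t) (Icc a b) → IsIntegralCurveOn y v (Icc a b) →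
    (∀ t ∈ Icc a b, ‖w t‖ ≤ W) →
    ‖x b - y b‖ ≤ c * Real.exp (-l * (b - a)) * ‖x a - y a‖ + g * W

variable {H : F →L[ℝ] F} {M β : ℝ}

/-- Young's inequality for the form of `H`: expand `0 ≤ ⟪H (β x - y), β x - y⟫` and divide by `β`.
-/
lemma two_mul_inner_le_add (hsymm : ∀ x y, ⟪H x, y⟫ = ⟪x, H y⟫) (hpos : ∀ x, 0 ≤ ⟪H x, x⟫)
    (hβ : 0 < β) (x y : F) : 2 * ⟪H x, y⟫ ≤ β * ⟪H x, x⟫ + ⟪H y, y⟫ / β := by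
  have h := hpos (β • x - y)
  have hs : ⟪H y, x⟫ = ⟪H x, y⟫ := by rw [hsymm, real_inner_comm]
  simp only [map_sub, map_smul, inner_sub_left, inner_sub_right, real_inner_smul_left,
    real_inner_smul_right, hs] at h
  have h2 : 0 ≤ (β * (β * ⟪H x, x⟫) - 2 * β * ⟪H x, y⟫ + ⟪H y, y⟫) / β :=
    div_nonneg (by linarith) hβ.le
  have h3 : (β * (β * ⟪H x, x⟫) - 2 * β * ⟪H x, y⟫ + ⟪H y, y⟫) / β
      = β * ⟪H x, x⟫ - 2 * ⟪H x, y⟫ + ⟪H y, y⟫ / β := by field_simp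
  linarith

/-- For `V = ⟪H e, e⟫`, Young's inequality spends half of the decay on the input: `V' ≤ -2βV + 2⟪H
e, w⟫ ≤ -βV + ⟪H w, w⟫ / β ≤ -β(V - κ)` with `κ = M W² / β²`. So `exp (β t) (V - κ)` is
nonincreasing. -/
lemma inner_le_of_dissipation (hsymm : ∀ x y, ⟪H x, y⟫ = ⟪x, H y⟫) (hpos : ∀ x, 0 ≤ ⟪H x, x⟫)
    (hM : ∀ x, ⟪H x, x⟫ ≤ M * ‖x‖ ^ 2) (hM0 : 0 ≤ M) (hβ : 0 < β) {e e' w : ℝ → F} {a b W : ℝ}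
    (hab : a ≤ b) (he : ∀ t ∈ Icc a b, HasDerivWithinAt e (e' t) (Icc a b) t)
    (hdis : ∀ t ∈ Icc a b, ⟪H (e t), e' t⟫ ≤ -β * ⟪H (e t), e t⟫ + ⟪H (e t), w t⟫)
    (hw : ∀ t ∈ Icc a b, ‖w t‖ ≤ W) :
    ⟪H (e b), e b⟫ ≤ Real.exp (-β * (b - a)) * ⟪H (e a), e a⟫ + M * W ^ 2 / β ^ 2 := by
  set κ : ℝ := M * W ^ 2 / β ^ 2 with hκ
  have hκ0 : 0 ≤ κ := by positivity
  have hder : ∀ t ∈ Icc a b, HasDerivWithinAt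
      (fun t => Real.exp (β * (t - a)) * (⟪H (e t), e t⟫ - κ))
      (Real.exp (β * (t - a)) * (β * (⟪H (e t), e t⟫ - κ) + 2 * ⟪H (e t), e' t⟫)) (Icc a b) t := by
    intro t ht
    have h1 : HasDerivWithinAt (fun t => Real.exp (β * (t - a)))
        (Real.exp (β * (t - a)) * β) (Icc a b) t := by
      have := (((hasDerivAt_id t).sub_const a).const_mul β).exp.hasDerivWithinAt (s := Icc a b)
      simpa using this
    have h2 : HasDerivWithinAt (fun t => ⟪H (e t), e t⟫ - κ)
        (⟪H (e t), e' t⟫ + ⟪H (e' t), e t⟫) (Icc a b) t :=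
      ((H.hasFDerivAt.comp_hasDerivWithinAt t (he t ht)).inner ℝ (he t ht)).sub_const κ
    have h3 : ⟪H (e' t), e t⟫ = ⟪H (e t), e' t⟫ := by rw [hsymm, real_inner_comm]
    refine (h1.mul h2).congr_deriv ?_
    rw [h3]
    ring
  have hanti : AntitoneOn (fun t => Real.exp (β * (t - a)) * (⟪H (e t), e t⟫ - κ)) (Icc a b) := by
    refine antitoneOn_of_hasDerivWithinAt_nonpos (convex_Icc a b)
      (fun t ht => (hder t ht).continuousWithinAt)
      (fun t ht => (hder t (interior_subset ht)).mono interior_subset) fun t ht => ?_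
    have ht := interior_subset ht
    refine mul_nonpos_of_nonneg_of_nonpos (Real.exp_pos _).le ?_
    have h1 := hdis t ht
    have h2 := two_mul_inner_le_add hsymm hpos hβ (e t) (w t)
    have h3 : ⟪H (w t), w t⟫ / β ≤ β * κ := by
      have : β * κ = M * W ^ 2 / β := by rw [hκ]; field_simp
      rw [this]
      gcongr
      refine (hM _).trans ?_
      have := hw t ht
      gcongr
    linarith
  have h := hanti (left_mem_Icc.2 hab) (right_mem_Icc.2 hab) hab
  simp only [sub_self, mul_zero, Real.exp_zero, one_mul] at h
  have h4 : Real.exp (-β * (b - a)) * (Real.exp (β * (b - a)) * (⟪H (e b), e b⟫ - κ))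
      ≤ Real.exp (-β * (b - a)) * (⟪H (e a), e a⟫ - κ) := by gcongr
  rw [← mul_assoc, ← Real.exp_add] at h4
  simp only [neg_mul, neg_add_cancel, Real.exp_zero, one_mul] at h4
  have h5 := mul_nonneg (Real.exp_pos (-(β * (b - a)))).le hκ0
  rw [neg_mul]
  linarith

/-- A quadratic Lyapunov function for the differences of trajectories yields incremental
stability, with constants that depend only on the Lyapunov function and the decay rate. -/
lemma exists_isIncrementallyStable (hsymm : ∀ x y, ⟪H x, y⟫ = ⟪x, H y⟫) {m : ℝ} (hm0 : 0 < m)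
    (hm : ∀ x, m * ‖x‖ ^ 2 ≤ ⟪H x, x⟫) (hβ : 0 < β) :
    ∃ c > 0, ∃ l > 0, ∃ g > 0, ∀ v : ℝ → F → F,
      (∀ t x y, ⟪H (x - y), v t x - v t y⟫ ≤ -β * ⟪H (x - y), x - y⟫) →
      IsIncrementallyStable v c l g := by
  have hpos : ∀ x, 0 ≤ ⟪H x, x⟫ := fun x => le_trans (by positivity) (hm x)
  set M : ℝ := ‖H‖ + 1
  have hM0 : 0 < M := by positivity
  have hM : ∀ x, ⟪H x, x⟫ ≤ M * ‖x‖ ^ 2 := fun x => by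
    calc _ ≤ ‖H x‖ * ‖x‖ := real_inner_le_norm _ _
      _ ≤ (‖H‖ * ‖x‖) * ‖x‖ := by gcongr; exact H.le_opNorm x
      _ ≤ (M * ‖x‖) * ‖x‖ := by gcongr; simp [M]
      _ = _ := by ring
  -- Taking the square root of `m ‖x‖² ≤ V ≤ M ‖x‖²` costs the factor `√(M / m)` and halves the
  -- rate.
  refine ⟨√(M / m), by positivity, β / 2, by positivity, √(M / m) / β, by positivity, ?_⟩
  intro v hv a b hab x y w W hx hy hw
  have hW0 : 0 ≤ W := (norm_nonneg _).trans (hw a (left_mem_Icc.2 hab))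
  have h := inner_le_of_dissipation (e := fun t => x t - y t)
    (e' := fun t => v t (x t) + w t - v t (y t)) (w := w) hsymm hpos hM hM0.le hβ hab
    (fun t ht => (hx t ht).sub (hy t ht)) (fun t _ => by
      have := hv t (x t) (y t)
      rw [add_sub_right_comm, inner_add_right]
      linarith) hw
  have h1 := hm (x b - y b)
  have h2 := hM (x a - y a)
  have hs : √(M / m) ^ 2 = M / m := Real.sq_sqrt (by positivity)
  have he : Real.exp (-β * (b - a)) = Real.exp (-(β / 2) * (b - a)) ^ 2 := by
    rw [← Real.exp_nat_mul]; congr 1; push_cast; ring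
  refine le_of_sq_le_sq ?_ (by positivity)
  have h3 : m * ‖x b - y b‖ ^ 2 ≤
      Real.exp (-(β / 2) * (b - a)) ^ 2 * (M * ‖x a - y a‖ ^ 2) + M * W ^ 2 / β ^ 2 := by
    rw [he] at h
    refine h1.trans (h.trans ?_)
    gcongr
  have h4 : ‖x b - y b‖ ^ 2 ≤ (√(M / m) * Real.exp (-(β / 2) * (b - a)) * ‖x a - y a‖) ^ 2
      + (√(M / m) / β * W) ^ 2 := by
    rw [mul_pow, mul_pow, mul_pow, div_pow, hs]
    have := (le_div_iff₀' hm0).2 h3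
    refine this.trans (le_of_eq ?_)
    field_simp
  -- The cross term in `p² + q² ≤ (p + q)²`.
  have h5 : 0 ≤ (√(M / m) * Real.exp (-(β / 2) * (b - a)) * ‖x a - y a‖) * (√(M / m) / β * W) := by
    positivity
  nlinarith

end Dissipative

/-! ### From incremental stability to convergence, periodicity and input bounds -/

section Convergence

variable {n : ℕ} {v : ℝ → Vec (Fin n) → Vec (Fin n)} {c l g C M : ℝ}

/-- By incremental stability, every solution is the restriction of a global one. -/
lemma forwardCompleteFrom_of_exists (hl : IsIncrementallyStable v c l g) {t₀ : ℝ}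
    (hex : ∀ x₀, ∃ x : ℝ → Vec (Fin n), x t₀ = x₀ ∧ IsIntegralCurveOn x v (Ici t₀)) :
    ForwardCompleteFrom v t₀ := by
  refine fun x₀ => ⟨hex x₀, fun b _ y hy0 hy => ?_⟩
  obtain ⟨x, hx0, hx⟩ := hex x₀
  refine ⟨x, hx, fun t ht => ?_⟩
  have h := hl t₀ t ht.1 x y 0 0
    (fun s hs => by simpa using (hx s hs.1).mono Icc_subset_Ici_self)
    (hy.mono fun s hs => ⟨hs.1, hs.2.trans_lt ht.2⟩) (by simp)
  rw [hx0, hy0] at h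
  simpa [sub_eq_zero] using h

/-- An incrementally stable system that is bounded at the origin has a bounded solution on `ℝ`. -/
lemma exists_isBoundedSolution (hl0 : 0 < l) (hl : IsIncrementallyStable v c l g)
    (hlip : ∀ t x y, ‖v t x - v t y‖ ≤ C * ‖x - y‖) (hC : 0 ≤ C) (hM : ∀ t, ‖v t 0‖ ≤ M)
    (hc : 0 ≤ c) (hg : 0 ≤ g)
    (hex : ∀ t₀ x₀, ∃ x : ℝ → Vec (Fin n), x t₀ = x₀ ∧ IsIntegralCurveOn x v (Ici t₀)) :
    ∃ xs, IsBoundedSolution v xs := by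
  have hM0 : 0 ≤ M := (norm_nonneg _).trans (hM 0)
  choose x hx0 hx using fun k : ℕ => hex (-(k : ℝ)) 0
  have hbd : ∀ (k : ℕ) t, -(k : ℝ) ≤ t → ‖x k t‖ ≤ g * M := fun k t ht => by
    -- The zero function is a trajectory under the input `-v(t, 0)`, which has size at most `M`.
    have h := hl (-(k : ℝ)) t ht 0 (x k) (fun t => -v t 0) M
      (fun s _ => (hasDerivWithinAt_const s _ (0 : Vec (Fin n))).congr_deriv (by simp))
      ((hx k).mono Icc_subset_Ici_self) (fun s _ => by simpa using hM s)
    simpa [hx0] using h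
  -- For `j ≥ k`, at time `-k` the solution `x k` vanishes and `x j` has norm at most `g * M`; from
  -- then on the gap decays.
  let ρ : ℕ → ℝ → ℝ := fun k t => c * Real.exp (-l * (t + k)) * (g * M)
  have hρ0 : ∀ k t, 0 ≤ ρ k t := fun k t => by positivity
  have hρ : ∀ t, Tendsto (fun k => ρ k t) atTop (𝓝 0) := fun t => by
    have h1 : Tendsto (fun k : ℕ => -l * (t + k)) atTop atBot :=
      (tendsto_atTop_add_const_left _ t tendsto_natCast_atTop_atTop).const_mul_atTop_of_neg
        (by linarith)
    simpa [ρ] using ((Real.tendsto_exp_atBot.comp h1).const_mul c).mul_const (g * M)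
  have hcmp : ∀ (j k : ℕ) t, k ≤ j → -(k : ℝ) ≤ t → ‖x j t - x k t‖ ≤ ρ k t := fun j k t hkj ht => by
    have hkj' : -(j : ℝ) ≤ -k := by simpa using hkj
    have h := hl (-(k : ℝ)) t ht (x j) (x k) 0 0
      (fun s hs => by simpa using (hx j s (hkj'.trans hs.1)).mono fun r hr => hkj'.trans hr.1)
      ((hx k).mono Icc_subset_Ici_self) (by simp)
    rw [hx0, sub_zero, mul_zero, add_zero, sub_neg_eq_add] at h
    exact h.trans (mul_le_mul_of_nonneg_left (hbd j _ hkj') (by positivity))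
  have hcauchy : ∀ t, CauchySeq fun k => x k t := fun t => by
    refine Metric.cauchySeq_iff'.2 fun ε hε => ?_
    obtain ⟨N, h1, h2⟩ := (((hρ t).eventually_lt_const hε).and
      (tendsto_natCast_atTop_atTop.eventually_ge_atTop (-t))).exists
    refine ⟨N, fun j hj => ?_⟩
    rw [dist_eq_norm]
    exact (hcmp j N t hj (by linarith)).trans_lt h1
  choose xs hxs using fun t => cauchySeq_tendsto_of_complete (hcauchy t)
  have hxs_le : ∀ (k : ℕ) t, -(k : ℝ) ≤ t → ‖xs t - x k t‖ ≤ ρ k t := fun k t ht =>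
    le_of_tendsto ((hxs t).sub_const _).norm
      (eventually_atTop.2 ⟨k, fun j hj => hcmp j k t hj ht⟩)
  refine ⟨xs, fun t => ?_, g * M, fun t => ?_⟩
  · obtain ⟨N, hN⟩ := exists_nat_gt (-t)
    -- To pass to the limit in the equation, the derivatives must converge uniformly near `t`. By
    -- the Lipschitz bound they do on `(-N, ∞)`, where `ρ k` is at most its value at `-N`.
    refine hasDerivAt_of_tendstoUniformlyOn (l := atTop) (s := Ioi (-(N : ℝ))) (f := x)
      (f' := fun k s => v s (x k s)) (g' := fun s => v s (xs s)) isOpen_Ioi ?_ ?_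
      (fun s _ => hxs s) (by simp only [mem_Ioi]; linarith)
    · rw [Metric.tendstoUniformlyOn_iff]
      intro ε hε
      have h0 : Tendsto (fun k => C * ρ k (-N)) atTop (𝓝 0) := by
        simpa using (hρ (-N)).const_mul C
      filter_upwards [h0.eventually_lt_const hε, eventually_ge_atTop N] with k hk hNk s hs
      have hNk' : -(k : ℝ) ≤ -N := by simpa using hNk
      rw [dist_eq_norm]
      have hs' : -(N : ℝ) ≤ s := (mem_Ioi.1 hs).le
      refine lt_of_le_of_lt ?_ hk
      refine (hlip _ _ _).trans (mul_le_mul_of_nonneg_left ?_ hC)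
      refine (hxs_le k s (hNk'.trans hs')).trans ?_
      simp only [ρ]
      gcongr ?_ * Real.exp ?_ * ?_
      nlinarith
    · filter_upwards [eventually_ge_atTop N] with k hNk s hs
      have hNk' : -(k : ℝ) ≤ -N := by simpa using hNk
      exact (hx k s (hNk'.trans (mem_Ioi.1 hs).le)).hasDerivAt
        (Ici_mem_nhds (hNk'.trans_lt hs))
  · obtain ⟨N, hN⟩ := exists_nat_gt (-t)
    refine le_of_tendsto (hxs t).norm (eventually_atTop.2 ⟨N, fun k hk => hbd k t ?_⟩)
    have : -(k : ℝ) ≤ -N := by simpa using hk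
    linarith

/-- Comparison from the initial time `t - k`: the initial gap stays bounded by `C₁ + C₂`, while its
weight tends to `0` as `k → ∞`. -/
lemma IsBoundedSolution.eq (hl0 : 0 < l) (hl : IsIncrementallyStable v c l g)
    {x y : ℝ → Vec (Fin n)} (hx : IsBoundedSolution v x)
    (hy : IsBoundedSolution v y) : x = y := by
  obtain ⟨hx, C₁, hC₁⟩ := hx
  obtain ⟨hy, C₂, hC₂⟩ := hy
  funext t
  have h1 : Tendsto (fun k : ℕ => -l * k) atTop atBot :=
    tendsto_natCast_atTop_atTop.const_mul_atTop_of_neg (by linarith)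
  have h2 : Tendsto (fun k : ℕ => |c| * Real.exp (-l * k) * (C₁ + C₂)) atTop (𝓝 0) := by
    simpa using ((Real.tendsto_exp_atBot.comp h1).const_mul |c|).mul_const (C₁ + C₂)
  have h3 : ‖x t - y t‖ ≤ 0 := ge_of_tendsto' h2 fun k => by
    have h := hl (t - k) t (by simp) x y 0 0
      (fun s _ => by simpa using (hx s).hasDerivWithinAt) (hy.isIntegralCurveOn _) (by simp)
    rw [mul_zero, add_zero, sub_sub_cancel] at h
    refine h.trans ?_
    gcongr
    · exact le_abs_self c
    exact (norm_sub_le _ _).trans (add_le_add (hC₁ _) (hC₂ _))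
  simpa [sub_eq_zero] using h3

/-- Global Lipschitz continuity, boundedness at the origin and incremental stability imply
convergence. -/
lemma isConvergent_of_isIncrementallyStable (hc : 0 < c) (hl0 : 0 < l) (hg : 0 ≤ g)
    (hl : IsIncrementallyStable v c l g) (hv : Continuous (Function.uncurry v)) (hC : 0 ≤ C)
    (hlip : ∀ t x y, ‖v t x - v t y‖ ≤ C * ‖x - y‖) (hM : ∀ t, ‖v t 0‖ ≤ M) :
    IsConvergent v := by
  have hex := exists_isIntegralCurveOn_Ici hv hC hlip hM
  obtain ⟨xs, hxs⟩ := exists_isBoundedSolution hl0 hl hlip hC hM hc.le hg hex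
  refine ⟨fun t₀ => forwardCompleteFrom_of_exists hl (hex t₀), xs,
    ⟨hxs, fun y hy => hy.eq hl0 hl hxs⟩, c, hc, l, hl0, fun t₀ x hx t ht => ?_⟩
  have h := hl t₀ t ht x xs 0 0
    (fun s hs => by simpa using (hx s hs.1).mono Icc_subset_Ici_self)
    (hxs.1.isIntegralCurveOn _) (by simp)
  simpa using h

/-- The shift by `θ` is again a bounded solution, so uniqueness applies. -/
lemma IsBoundedSolution.periodic (hl0 : 0 < l) (hl : IsIncrementallyStable v c l g)
    {xs : ℝ → Vec (Fin n)} (hxs : IsBoundedSolution v xs) {θ : ℝ}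
    (hθ : ∀ t x, v (t + θ) x = v t x) : Function.Periodic xs θ := by
  have h : IsBoundedSolution v fun t => xs (t + θ) := by
    refine ⟨fun t => ?_, hxs.2.imp fun C hC t => hC _⟩
    have h := (hxs.1 (t + θ)).comp_add_const t θ
    rwa [hθ] at h
  exact congrFun (h.eq hl0 hl hxs)

lemma isClassKL_mul_exp (hc : 0 < c) (hl0 : 0 < l) :
    IsClassKL fun ρ t => c * Real.exp (-l * t) * ρ := by
  refine ⟨by unfold Function.uncurry; fun_prop, fun t _ => ⟨by simp, by fun_prop, ?_⟩,
    fun ρ hρ => ⟨?_, ?_⟩⟩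
  · exact (strictMono_mul_left_of_pos (by positivity)).strictMonoOn _
  · intro s _ t _ hst
    simp only
    gcongr ?_ * Real.exp ?_ * ?_
    nlinarith
  · have h1 : Tendsto (fun t : ℝ => -l * t) atTop atBot :=
      tendsto_id.const_mul_atTop_of_neg (by linarith)
    simpa using ((Real.tendsto_exp_atBot.comp h1).const_mul c).mul_const ρ

lemma isClassKInfty_const_mul (hg : 0 < g) : IsClassKInfty fun s => g * s :=
  ⟨⟨by simp, by fun_prop, (strictMono_mul_left_of_pos hg).strictMonoOn _⟩,
    tendsto_id.const_mul_atTop hg⟩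

/-- The system with an additional input bounded on `[0, ∞)` is forward complete. -/
lemma forwardCompleteFrom_add (hv : Continuous (Function.uncurry v)) (hC : 0 ≤ C)
    (hlip : ∀ t x y, ‖v t x - v t y‖ ≤ C * ‖x - y‖) (hM : ∀ t, ‖v t 0‖ ≤ M)
    {w : ℝ → Vec (Fin n)} (hl : IsIncrementallyStable (fun t x => v t x + w t) c l g)
    (hw : ContinuousOn w (Ici 0)) (hwb : ∃ C : ℝ, ∀ t, 0 ≤ t → ‖w t‖ ≤ C) :
    ForwardCompleteFrom (fun t x => v t x + w t) 0 := by
  refine forwardCompleteFrom_of_exists hl fun x₀ => ?_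
  obtain ⟨W, hW⟩ := hwb
  -- Extending `w` by `w 0` to negative times makes the field continuous on the whole line without
  -- changing it on `[0, ∞)`.
  have hwc : Continuous fun t => w (max t 0) :=
    hw.comp_continuous (by fun_prop) fun t => mem_Ici.2 (le_max_right _ _)
  obtain ⟨x, hx0, hx⟩ := exists_isIntegralCurveOn_Ici (v := fun t x => v t x + w (max t 0))
    (C := C) (M := M + W) (hv.add (hwc.comp continuous_fst)) hC (fun t x y => by simpa using hlip t x y)
    (fun t => (norm_add_le _ _).trans (add_le_add (hM t) (hW _ (le_max_right _ _)))) 0 x₀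
  refine ⟨x, hx0, fun t ht => ?_⟩
  have := hx t ht
  simp only at this
  rwa [max_eq_left ht] at this

lemma norm_sub_le_of_input (hl : IsIncrementallyStable v c l g)
    {xs : ℝ → Vec (Fin n)} (hxs : IsIntegralCurve xs v) {w : ℝ → Vec (Fin n)}
    (hwb : ∃ C : ℝ, ∀ t, 0 ≤ t → ‖w t‖ ≤ C) {x : ℝ → Vec (Fin n)}
    (hx : IsIntegralCurveOn x (fun t x => v t x + w t) (Ici 0)) {t : ℝ} (ht : 0 ≤ t) :
    ‖x t - xs t‖ ≤ c * Real.exp (-l * t) * ‖x 0 - xs 0‖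
      + g * sSup ((fun σ => ‖w σ‖) '' Icc 0 t) := by
  obtain ⟨W, hW⟩ := hwb
  have h := hl 0 t ht x xs w (sSup ((fun σ => ‖w σ‖) '' Icc 0 t)) (hx.mono Icc_subset_Ici_self)
    -- Boundedness of `w` ensures that the supremum really is an upper bound.
    (hxs.isIntegralCurveOn _) fun s hs =>
      le_csSup ⟨W, by rintro _ ⟨r, hr, rfl⟩; exact hW r hr.1⟩ (mem_image_of_mem _ hs)
  simpa using h

end Convergence

/-! ### The matrix inequality as a robust contraction estimate -/

section LMI

variable {n r q τ T : ℕ}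

lemma dotProduct_transpose_mulVec_comm {ι κ : Type*} [Fintype ι] [Fintype κ] (M : Matrix ι κ ℝ)
    (x : κ → ℝ) (y : ι → ℝ) : x ⬝ᵥ (Mᵀ *ᵥ y) = y ⬝ᵥ (M *ᵥ x) := by
  rw [Matrix.mulVec_transpose, dotProduct_comm, Matrix.dotProduct_mulVec]

/-- The quadratic form of the linear matrix inequality. -/
lemma lmiMatrix_quadratic_form_nonpos {X₁ : Matrix (Fin n) (Fin T) ℝ}
    {E : Matrix (Fin n) (Fin q) ℝ} {κ : ℝ} {R : Matrix (Fin n) (Fin τ) ℝ}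
    {P : Matrix (Fin n) (Fin n) ℝ} {Y₁ : Matrix (Fin T) (Fin n) ℝ} {G₂ : Matrix (Fin T) (Fin r) ℝ}
    {α μ : ℝ}
    (h : (-(lmiMatrix X₁ E (κ • (1 : Matrix (Fin q) (Fin q) ℝ)) R P Y₁ G₂ α μ)).PosSemidef)
    (u : Fin n → ℝ) (a : Fin r → ℝ) (b : Fin τ → ℝ) (c : Fin T → ℝ) :
    2 * (u ⬝ᵥ (X₁ *ᵥ (Y₁ *ᵥ u + G₂ *ᵥ a))) + α * (u ⬝ᵥ u)
      + μ * κ ^ 2 * ((Eᵀ *ᵥ u) ⬝ᵥ (Eᵀ *ᵥ u)) - a ⬝ᵥ a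
      + 2 * (b ⬝ᵥ ((Rᵀ * P) *ᵥ u)) - b ⬝ᵥ b + 2 * (c ⬝ᵥ (Y₁ *ᵥ u + G₂ *ᵥ a)) - μ * (c ⬝ᵥ c) ≤ 0 := by
  have h0 := h.dotProduct_mulVec_nonneg (Sum.elim (Sum.elim u a) (Sum.elim b c))
  have e1 : u ⬝ᵥ (Y₁ᵀ *ᵥ (X₁ᵀ *ᵥ u)) = u ⬝ᵥ (X₁ *ᵥ (Y₁ *ᵥ u)) := by
    rw [dotProduct_transpose_mulVec_comm, dotProduct_comm, dotProduct_transpose_mulVec_comm]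
  have e2 : a ⬝ᵥ (G₂ᵀ *ᵥ (X₁ᵀ *ᵥ u)) = u ⬝ᵥ (X₁ *ᵥ (G₂ *ᵥ a)) := by
    rw [dotProduct_transpose_mulVec_comm, dotProduct_comm, dotProduct_transpose_mulVec_comm]
  have e3 : u ⬝ᵥ (Pᵀ *ᵥ (R *ᵥ b)) = b ⬝ᵥ (Rᵀ *ᵥ (P *ᵥ u)) := by
    rw [dotProduct_transpose_mulVec_comm, dotProduct_transpose_mulVec_comm, dotProduct_comm]
  have e4 : u ⬝ᵥ (Y₁ᵀ *ᵥ c) = c ⬝ᵥ (Y₁ *ᵥ u) := dotProduct_transpose_mulVec_comm _ _ _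
  have e5 : a ⬝ᵥ (G₂ᵀ *ᵥ c) = c ⬝ᵥ (G₂ *ᵥ a) := dotProduct_transpose_mulVec_comm _ _ _
  have e6 : (Eᵀ *ᵥ u) ⬝ᵥ (Eᵀ *ᵥ u) = u ⬝ᵥ (E *ᵥ (Eᵀ *ᵥ u)) :=
    dotProduct_transpose_mulVec_comm _ _ _
  simp only [lmiMatrix, star_trivial, Matrix.neg_mulVec, dotProduct_neg, Matrix.fromBlocks_mulVec,
    sumElim_dotProduct_sumElim, Sum.elim_comp_inl, Sum.elim_comp_inr, Matrix.add_mulVec,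
    Matrix.smul_mulVec, Matrix.one_mulVec, Matrix.zero_mulVec, dotProduct_add, dotProduct_smul,
    dotProduct_zero, Matrix.transpose_mul, Matrix.transpose_transpose, ← Matrix.mulVec_mulVec,
    Matrix.transpose_smul, Matrix.transpose_one, Matrix.smul_mul, Matrix.mul_smul, Matrix.mul_one,
    smul_eq_mul, e1, e2, e3, e4, e5, add_zero] at h0
  simp only [Matrix.mulVec_add, dotProduct_add, e6, ← Matrix.mulVec_mulVec]
  linarith

/-- The S-procedure: feasibility of the linear matrix inequality makes the closed-loop Jacobian
contracting for all disturbance data `D` compatible with the bound. -/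
lemma two_mul_dotProduct_le_of_lmi {X₁ : Matrix (Fin n) (Fin T) ℝ} {E : Matrix (Fin n) (Fin q) ℝ}
    {κ : ℝ} {R : Matrix (Fin n) (Fin τ) ℝ} {P : Matrix (Fin n) (Fin n) ℝ}
    {Y₁ : Matrix (Fin T) (Fin n) ℝ} {G₂ : Matrix (Fin T) (Fin r) ℝ} {α μ : ℝ} (hμ : 0 < μ)
    (h : (-(lmiMatrix X₁ E (κ • (1 : Matrix (Fin q) (Fin q) ℝ)) R P Y₁ G₂ α μ)).PosSemidef)
    {D : Matrix (Fin q) (Fin T) ℝ} (hD : ∀ y, (Dᵀ *ᵥ y) ⬝ᵥ (Dᵀ *ᵥ y) ≤ κ ^ 2 * (y ⬝ᵥ y))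
    (u : Fin n → ℝ) (a : Fin r → ℝ)
    (ha : a ⬝ᵥ a ≤ (Rᵀ *ᵥ (P *ᵥ u)) ⬝ᵥ (Rᵀ *ᵥ (P *ᵥ u))) :
    2 * (u ⬝ᵥ ((X₁ - E * D) *ᵥ (Y₁ *ᵥ u + G₂ *ᵥ a))) ≤ -α * (u ⬝ᵥ u) := by
  -- With `b = RᵀPu`, the terms in `b` contribute `|RᵀPu|² ≥ |a|²`, which offsets `-|a|²`. With `c =
  -- -DᵀEᵀu`, the cross term becomes `-2 u·ED(Y₁u + G₂a)`, and `-μ|c|²` is offset by `μκ²|Eᵀu|²`.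
  have h0 := lmiMatrix_quadratic_form_nonpos h u a (Rᵀ *ᵥ (P *ᵥ u)) (-(Dᵀ *ᵥ (Eᵀ *ᵥ u)))
  have h1 := hD (Eᵀ *ᵥ u)
  have h2 : (Dᵀ *ᵥ (Eᵀ *ᵥ u)) ⬝ᵥ (Y₁ *ᵥ u + G₂ *ᵥ a)
      = u ⬝ᵥ (E *ᵥ (D *ᵥ (Y₁ *ᵥ u + G₂ *ᵥ a))) := by
    rw [dotProduct_comm, dotProduct_transpose_mulVec_comm, dotProduct_comm,
      dotProduct_transpose_mulVec_comm]
  rw [Matrix.sub_mulVec, dotProduct_sub, ← Matrix.mulVec_mulVec]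
  rw [← Matrix.mulVec_mulVec, neg_dotProduct, h2, neg_dotProduct, dotProduct_neg, neg_neg] at h0
  have h3 := mul_le_mul_of_nonneg_left h1 hμ.le
  linarith

end LMI

/-! ### Data-based representation and the disturbance bound -/

section Data

variable {n m r q T : ℕ} {f : Vec (Fin n) → Vec (Fin n)} {A : Matrix (Fin n) (Fin n ⊕ Fin r) ℝ}
  {B : Matrix (Fin n) (Fin m) ℝ} {E : Matrix (Fin n) (Fin q) ℝ} {Q : Vec (Fin n) → Vec (Fin r)}

/-- The matrix `D₀ = [d_0 … d_{T-1}]` of the unknown disturbance samples. -/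
def Experiment.D0 (e : Experiment f B E T) : Matrix (Fin q) (Fin T) ℝ :=
  Matrix.of fun i k => e.disturbance (e.time k) i

lemma Experiment.X1_eq (e : Experiment f B E T) (hf : ∀ x, f x = mulV A (dict Q x)) :
    e.X1 = A * e.Z0 Q + B * e.U0 + E * e.D0 := by
  ext i k
  simp only [Experiment.X1, Matrix.of_apply, e.plant k, hf]
  rfl

/-- Each of the `T` entries of `D₀ᵀy` is the inner product of `y` with a sample, hence at most
`δ‖y‖` in modulus; summing the squares produces the factor `√T` in `Δ`. -/
lemma Experiment.D0_bound (e : Experiment f B E T) {δ : ℝ}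
    (he : ∀ i, ‖e.disturbance (e.time i)‖ ≤ δ) (y : Fin q → ℝ) :
    (e.D0ᵀ *ᵥ y) ⬝ᵥ (e.D0ᵀ *ᵥ y) ≤ (δ * √(T : ℝ)) ^ 2 * (y ⬝ᵥ y) := by
  have hy : ‖(WithLp.toLp 2 y : Vec (Fin q))‖ ^ 2 = y ⬝ᵥ y := by
    rw [EuclideanSpace.real_norm_sq_eq]
    simp only [dotProduct, sq]
  have hk : ∀ k, (e.D0ᵀ *ᵥ y) k * (e.D0ᵀ *ᵥ y) k ≤ δ ^ 2 * (y ⬝ᵥ y) := fun k => by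
    have h1 : (e.D0ᵀ *ᵥ y) k
        = inner ℝ (WithLp.toLp 2 y : Vec (Fin q)) (e.disturbance (e.time k)) := by
      simp [EuclideanSpace.inner_eq_star_dotProduct, Matrix.mulVec, dotProduct, Experiment.D0]
    have h2 := abs_real_inner_le_norm (WithLp.toLp 2 y : Vec (Fin q)) (e.disturbance (e.time k))
    rw [h1, ← sq, ← sq_abs, ← hy, ← mul_pow]
    gcongr
    rw [mul_comm]
    refine h2.trans ?_
    gcongr
    exact he k
  calc _ ≤ ∑ _k : Fin T, δ ^ 2 * (y ⬝ᵥ y) := Finset.sum_le_sum fun k _ => hk k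
    _ = _ := by
      rw [mul_pow, Real.sq_sqrt (Nat.cast_nonneg T)]
      simp
      ring

/-- The data-based representation of the closed loop. -/
lemma add_mul_gain_eq (e : Experiment f B E T) (hf : ∀ x, f x = mulV A (dict Q x))
    {P : Matrix (Fin n) (Fin n) ℝ} (hP : P.PosDef) {Y₁ : Matrix (Fin T) (Fin n) ℝ}
    {G₂ : Matrix (Fin T) (Fin r) ℝ} (h1 : e.Z0 Q * Y₁ = Matrix.fromRows P 0)
    (h2 : e.Z0 Q * G₂ = Matrix.fromRows 0 1) :
    A + B * gain e.U0 P Y₁ G₂ = (e.X1 - E * e.D0) * Matrix.fromCols (Y₁ * P⁻¹) G₂ := by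
  have hZ : e.Z0 Q * Matrix.fromCols (Y₁ * P⁻¹) G₂ = 1 := by
    rw [Matrix.mul_fromCols, ← Matrix.mul_assoc, h1, h2, Matrix.fromRows_mul,
      Matrix.mul_nonsing_inv _ ((Matrix.isUnit_iff_isUnit_det _).1 hP.isUnit), Matrix.zero_mul,
      Matrix.fromCols_fromRows_eq_fromBlocks, Matrix.fromBlocks_one]
  rw [e.X1_eq hf, add_sub_cancel_right, Matrix.add_mul, Matrix.mul_assoc A, hZ, Matrix.mul_one,
    gain, Matrix.mul_assoc]

end Data

/-! ### Contraction of the closed loop in the metric `P⁻¹` -/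

section ClosedLoop

variable {n r τ : ℕ}

/-- The matrix-vector product as a continuous linear map. -/
noncomputable def mulVL {ι κ : Type} [Fintype ι] [Fintype κ] (M : Matrix ι κ ℝ) : Vec κ →L[ℝ] Vec ι :=
  LinearMap.toContinuousLinearMap
    { toFun := mulV M
      map_add' := fun x y => by simp [mulV, Matrix.mulVec_add]
      map_smul' := fun c x => by simp [mulV, Matrix.mulVec_smul] }

@[simp] lemma mulVL_apply {ι κ : Type} [Fintype ι] [Fintype κ] (M : Matrix ι κ ℝ) (x : Vec κ) :
    mulVL M x = mulV M x := rfl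

lemma inner_eq_dotProduct {ι : Type} [Fintype ι] (x y : Vec ι) :
    inner ℝ x y = x.ofLp ⬝ᵥ y.ofLp := by
  rw [EuclideanSpace.inner_eq_star_dotProduct, star_trivial, dotProduct_comm]

lemma jacobian_mulVec (Q : Vec (Fin n) → Vec (Fin r)) (x w : Vec (Fin n)) :
    jacobian Q x *ᵥ w.ofLp = (fderiv ℝ Q x w).ofLp := by
  have hw : w = ∑ j, w j • EuclideanSpace.single j (1 : ℝ) := by
    ext i
    simp [Finset.sum_apply, Pi.single_apply]
  conv_rhs => rw [hw]
  ext i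
  simp [jacobian, Matrix.mulVec, dotProduct, mul_comm]

lemma fderiv_dotProduct_self_le {Q : Vec (Fin n) → Vec (Fin r)} {R : Matrix (Fin n) (Fin τ) ℝ}
    {x : Vec (Fin n)} (hR : (R * Rᵀ - (jacobian Q x)ᵀ * jacobian Q x).PosSemidef)
    (w : Vec (Fin n)) :
    (fderiv ℝ Q x w).ofLp ⬝ᵥ (fderiv ℝ Q x w).ofLp ≤ (Rᵀ *ᵥ w.ofLp) ⬝ᵥ (Rᵀ *ᵥ w.ofLp) := by
  have h := hR.dotProduct_mulVec_nonneg w.ofLp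
  rw [star_trivial, Matrix.sub_mulVec, dotProduct_sub, ← Matrix.mulVec_mulVec,
    ← Matrix.mulVec_mulVec, dotProduct_transpose_mulVec_comm (jacobian Q x),
    ← dotProduct_transpose_mulVec_comm R, jacobian_mulVec] at h
  linarith

/-- Mean value inequality. As the Jacobian bound holds everywhere, it makes the closed loop globally
Lipschitz, which rules out finite escape. -/
lemma norm_sub_le_of_jacobian_bound {Q : Vec (Fin n) → Vec (Fin r)} (hQ : Differentiable ℝ Q)
    {R : Matrix (Fin n) (Fin τ) ℝ}
    (hR : ∀ x, (R * Rᵀ - (jacobian Q x)ᵀ * jacobian Q x).PosSemidef) (x y : Vec (Fin n)) :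
    ‖Q x - Q y‖ ≤ ‖mulVL Rᵀ‖ * ‖x - y‖ := by
  refine convex_univ.norm_image_sub_le_of_norm_fderiv_le (𝕜 := ℝ) (fun z _ => hQ z) (fun z _ => ?_)
    (mem_univ y) (mem_univ x)
  refine ContinuousLinearMap.opNorm_le_bound _ (norm_nonneg _) fun w => ?_
  have h := fderiv_dotProduct_self_le (hR z) w
  refine le_trans ?_ ((mulVL Rᵀ).le_opNorm w)
  refine le_of_sq_le_sq ?_ (norm_nonneg _)
  rw [← real_inner_self_eq_norm_sq, ← real_inner_self_eq_norm_sq, inner_eq_dotProduct,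
    inner_eq_dotProduct]
  exact h

lemma norm_dict_sub_le {Q : Vec (Fin n) → Vec (Fin r)} {C : ℝ}
    (hQ : ∀ x y, ‖Q x - Q y‖ ≤ C * ‖x - y‖) (hC : 0 ≤ C) (x y : Vec (Fin n)) :
    ‖dict Q x - dict Q y‖ ≤ (1 + C) * ‖x - y‖ := by
  refine le_of_sq_le_sq ?_ (by positivity)
  have h : ‖dict Q x - dict Q y‖ ^ 2 = ‖x - y‖ ^ 2 + ‖Q x - Q y‖ ^ 2 := by
    simp [EuclideanSpace.real_norm_sq_eq, dict]
  have h1 : ‖Q x - Q y‖ ^ 2 ≤ (C * ‖x - y‖) ^ 2 := by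
    gcongr
    exact hQ x y
  rw [h]
  nlinarith [mul_nonneg hC (sq_nonneg ‖x - y‖)]

lemma hasDerivAt_dict_line {Q : Vec (Fin n) → Vec (Fin r)} (hQ : Differentiable ℝ Q)
    (y w : Vec (Fin n)) (s : ℝ) :
    HasDerivAt (fun s : ℝ => dict Q (y + s • w))
      (WithLp.toLp 2 (Sum.elim w.ofLp (fderiv ℝ Q (y + s • w) w).ofLp)) s := by
  have hl : HasDerivAt (fun s : ℝ => y + s • w) w s := by
    simpa using ((hasDerivAt_id s).smul_const w).const_add y
  have hq := (hQ (y + s • w)).hasFDerivAt.comp_hasDerivAt s hl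
  have hp : HasDerivAt (fun (s : ℝ) (i : Fin n ⊕ Fin r) => dict Q (y + s • w) i)
      (Sum.elim w.ofLp (fderiv ℝ Q (y + s • w) w).ofLp) s := by
    refine hasDerivAt_pi.2 ?_
    rintro (i | i)
    · exact (EuclideanSpace.proj (𝕜 := ℝ) i).hasFDerivAt.comp_hasDerivAt s hl
    · exact (EuclideanSpace.proj (𝕜 := ℝ) i).hasFDerivAt.comp_hasDerivAt s hq
  exact (PiLp.hasFDerivAt_toLp (𝕜 := ℝ) 2 _).comp_hasDerivAt s hp

lemma mulVL_inv_mulVL {P : Matrix (Fin n) (Fin n) ℝ} (hP : P.PosDef) (x : Vec (Fin n)) :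
    mulVL P (mulVL P⁻¹ x) = x := by
  simp [mulV, Matrix.mul_nonsing_inv _ ((Matrix.isUnit_iff_isUnit_det _).1 hP.isUnit)]

lemma inner_mulVL_inv_comm {P : Matrix (Fin n) (Fin n) ℝ} (hP : P.PosDef) (x y : Vec (Fin n)) :
    inner ℝ (mulVL P⁻¹ x) y = inner ℝ x (mulVL P⁻¹ y) := by
  have h : (P⁻¹)ᵀ = P⁻¹ := by simpa using hP.isHermitian.inv.eq
  rw [real_inner_comm, inner_eq_dotProduct, inner_eq_dotProduct]
  simp only [mulVL_apply, mulV]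
  rw [← dotProduct_transpose_mulVec_comm, h]

lemma inner_mulVL_inv_self_nonneg {P : Matrix (Fin n) (Fin n) ℝ} (hP : P.PosDef)
    (x : Vec (Fin n)) : 0 ≤ inner ℝ (mulVL P⁻¹ x) x := by
  rw [inner_mulVL_inv_comm hP, inner_eq_dotProduct]
  simpa [mulV] using hP.inv.posSemidef.dotProduct_mulVec_nonneg x.ofLp

/-- Young's inequality for `P⁻¹` at `x` and `P x` reads `2‖x‖² ≤ L⟨P⁻¹x, x⟩ + ⟨Px, x⟩ / L`, and the
last term is at most `‖x‖²`. -/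
lemma norm_sq_le_inner_mulVL_inv {P : Matrix (Fin n) (Fin n) ℝ} (hP : P.PosDef)
    (x : Vec (Fin n)) : (‖mulVL P‖ + 1)⁻¹ * ‖x‖ ^ 2 ≤ inner ℝ (mulVL P⁻¹ x) x := by
  set L : ℝ := ‖mulVL P‖ + 1
  have hL : 0 < L := by positivity
  have hinv : ∀ y, mulVL P⁻¹ (mulVL P y) = y := fun y => by
    simp [mulV, Matrix.nonsing_inv_mul _ ((Matrix.isUnit_iff_isUnit_det _).1 hP.isUnit)]
  have h1 : inner ℝ (mulVL P x) x ≤ L * ‖x‖ ^ 2 := by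
    calc _ ≤ ‖mulVL P x‖ * ‖x‖ := real_inner_le_norm _ _
      _ ≤ (‖mulVL P‖ * ‖x‖) * ‖x‖ := by gcongr; exact (mulVL P).le_opNorm x
      _ ≤ (L * ‖x‖) * ‖x‖ := by gcongr; simp [L]
      _ = _ := by ring
  have h2 := two_mul_inner_le_add (inner_mulVL_inv_comm hP) (inner_mulVL_inv_self_nonneg hP) hL
    x (mulVL P x)
  rw [inner_mulVL_inv_comm hP x, hinv, real_inner_self_eq_norm_sq,
    real_inner_comm (mulVL P x) x] at h2
  have h3 : inner ℝ (mulVL P x) x / L ≤ ‖x‖ ^ 2 := by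
    rw [div_le_iff₀ hL]
    linarith
  rw [inv_mul_le_iff₀ hL]
  linarith

/-- With `w = x - y` and `u = P⁻¹w`, the function `s ↦ ⟨u, N Z(y + s w)⟩` has derivative `u·N[Pu;
a]`, where `a = DQ(y + s w) w` is admissible by the Jacobian bound. So the derivative is at most
`-(α/2)‖u‖²`, and `⟨u, w⟩ = ⟨u, Pu⟩ ≤ (‖P‖ + 1)‖u‖²` converts this into the stated rate. The mean
value inequality on `[0, 1]` concludes. -/
lemma dissipative_of_matrix_bound {Q : Vec (Fin n) → Vec (Fin r)} (hQ : Differentiable ℝ Q)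
    {R : Matrix (Fin n) (Fin τ) ℝ}
    (hR : ∀ x, (R * Rᵀ - (jacobian Q x)ᵀ * jacobian Q x).PosSemidef)
    {P : Matrix (Fin n) (Fin n) ℝ} (hP : P.PosDef) {N : Matrix (Fin n) (Fin n ⊕ Fin r) ℝ} {α : ℝ}
    (hα : 0 < α) (hN : ∀ (u : Fin n → ℝ) (a : Fin r → ℝ),
      a ⬝ᵥ a ≤ (Rᵀ *ᵥ (P *ᵥ u)) ⬝ᵥ (Rᵀ *ᵥ (P *ᵥ u)) →
      2 * (u ⬝ᵥ (N *ᵥ Sum.elim (P *ᵥ u) a)) ≤ -α * (u ⬝ᵥ u)) (x y : Vec (Fin n)) :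
    inner ℝ (mulVL P⁻¹ (x - y)) (mulV N (dict Q x) - mulV N (dict Q y))
      ≤ -(α / (2 * (‖mulVL P‖ + 1))) * inner ℝ (mulVL P⁻¹ (x - y)) (x - y) := by
  set w := x - y with hw
  set u := mulVL P⁻¹ w with hu
  have hPu : mulVL P u = w := mulVL_inv_mulVL hP w
  have hPu' : P *ᵥ u.ofLp = w.ofLp := congrArg WithLp.ofLp hPu
  have hder : ∀ s, HasDerivAt (fun s : ℝ => inner ℝ u (mulVL N (dict Q (y + s • w))))
      (inner ℝ u (mulVL N (WithLp.toLp 2 (Sum.elim w.ofLp (fderiv ℝ Q (y + s • w) w).ofLp)))) s :=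
    fun s => by
      have h := (hasDerivAt_const s u).inner ℝ
        ((mulVL N).hasFDerivAt.comp_hasDerivAt s (hasDerivAt_dict_line hQ y w s))
      simpa using h
  have hbound : ∀ s : ℝ,
      inner ℝ u (mulVL N (WithLp.toLp 2 (Sum.elim w.ofLp (fderiv ℝ Q (y + s • w) w).ofLp)))
        ≤ -(α / (2 * (‖mulVL P‖ + 1))) * inner ℝ u w := fun s => by
    have h1 := hN u.ofLp (fderiv ℝ Q (y + s • w) w).ofLp (by
      rw [hPu']; exact fderiv_dotProduct_self_le (hR _) w)
    rw [hPu', ← inner_eq_dotProduct u u, real_inner_self_eq_norm_sq] at h1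
    have h2 : inner ℝ u w ≤ (‖mulVL P‖ + 1) * ‖u‖ ^ 2 := by
      calc inner ℝ u w ≤ ‖u‖ * ‖w‖ := real_inner_le_norm _ _
        _ ≤ ‖u‖ * (‖mulVL P‖ * ‖u‖) := by
          gcongr
          conv_lhs => rw [← hPu]
          exact (mulVL P).le_opNorm u
        _ ≤ _ := by nlinarith [sq_nonneg ‖u‖]
    have h3 : α / (2 * (‖mulVL P‖ + 1)) * inner ℝ u w ≤ α / 2 * ‖u‖ ^ 2 := by
      calc _ ≤ α / (2 * (‖mulVL P‖ + 1)) * ((‖mulVL P‖ + 1) * ‖u‖ ^ 2) := by gcongr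
        _ = _ := by field_simp
    rw [inner_eq_dotProduct, mulVL_apply, mulV]
    linarith
  have h := image_sub_le_mul_sub_of_deriv_le (fun s => (hder s).differentiableAt)
    (fun s => (hder s).deriv.trans_le (hbound s)) (zero_le_one (α := ℝ))
  simp only [one_smul, zero_smul, add_zero, sub_zero, mul_one, mulVL_apply] at h
  rw [← inner_sub_right, hw, add_sub_cancel] at h
  exact h

end ClosedLoop

/-- The closed loop is globally Lipschitz, bounded at the origin, and incrementally stable under
every additional input, with uniform constants. -/
lemma closedLoop_properties {n m r q τ T : ℕ} {f : Vec (Fin n) → Vec (Fin n)}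
    {A : Matrix (Fin n) (Fin n ⊕ Fin r) ℝ} {B : Matrix (Fin n) (Fin m) ℝ}
    {E : Matrix (Fin n) (Fin q) ℝ} {Q : Vec (Fin n) → Vec (Fin r)} (hQ : Differentiable ℝ Q)
    (hf : ∀ x, f x = mulV A (dict Q x)) {R : Matrix (Fin n) (Fin τ) ℝ}
    (hR : ∀ x, (R * Rᵀ - (jacobian Q x)ᵀ * jacobian Q x).PosSemidef) {δ : ℝ}
    (e : Experiment f B E T) (he : ∀ i, ‖e.disturbance (e.time i)‖ ≤ δ)
    {P : Matrix (Fin n) (Fin n) ℝ} {Y₁ : Matrix (Fin T) (Fin n) ℝ} {G₂ : Matrix (Fin T) (Fin r) ℝ}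
    {α μ : ℝ} (hSDP : IsFeasible e.X1 (e.Z0 Q) E ((δ * √(T : ℝ)) • (1 : Matrix (Fin q) (Fin q) ℝ))
      R P Y₁ G₂ α μ) {d : ℝ → Vec (Fin q)} (hd : Continuous d) (hdδ : ∀ t, ‖d t‖ ≤ δ) :
    let v := closedLoop A B E Q (gain e.U0 P Y₁ G₂) d
    Continuous (Function.uncurry v) ∧
    (∃ C, 0 ≤ C ∧ ∀ t x y, ‖v t x - v t y‖ ≤ C * ‖x - y‖) ∧
    (∃ M, ∀ t, ‖v t 0‖ ≤ M) ∧
    ∃ c > 0, ∃ l > 0, ∃ g > 0, ∀ w : ℝ → Vec (Fin n),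
      IsIncrementallyStable (fun t x => v t x + w t) c l g := by
  intro v
  have hP := hSDP.posDef
  have hdict := norm_dict_sub_le (norm_sub_le_of_jacobian_bound hQ hR) (norm_nonneg _)
  have hdict_cont : Continuous (dict Q) :=
    (LipschitzWith.of_dist_le_mul (K := Real.toNNReal (1 + ‖mulVL Rᵀ‖)) fun x y => by
      rw [dist_eq_norm, dist_eq_norm, Real.coe_toNNReal _ (by positivity)]
      exact hdict x y).continuous
  set N := A + B * gain e.U0 P Y₁ G₂ with hN
  have hv : ∀ t x, v t x = mulVL N (dict Q x) + mulVL E (d t) := fun _ _ => rfl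
  have hdis := dissipative_of_matrix_bound hQ hR hP hSDP.alpha_pos (N := N) fun u a ha => by
    have h := two_mul_dotProduct_le_of_lmi hSDP.mu_pos hSDP.lmi (e.D0_bound he) u a ha
    rwa [hN, add_mul_gain_eq e hf hP hSDP.eq_left hSDP.eq_right, ← Matrix.mulVec_mulVec,
      Matrix.fromCols_mulVec_sumElim, Matrix.mulVec_mulVec, Matrix.mul_assoc,
      Matrix.nonsing_inv_mul _ ((Matrix.isUnit_iff_isUnit_det _).1 hP.isUnit), Matrix.mul_one]
  refine ⟨?_, ⟨‖mulVL N‖ * (1 + ‖mulVL Rᵀ‖), by positivity, fun t x y => ?_⟩,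
    ⟨‖mulVL N (dict Q 0)‖ + ‖mulVL E‖ * δ, fun t => ?_⟩, ?_⟩
  · exact ((mulVL N).continuous.comp (hdict_cont.comp continuous_snd)).add
      ((mulVL E).continuous.comp (hd.comp continuous_fst))
  · rw [hv, hv, add_sub_add_right_eq_sub, ← map_sub, mul_assoc]
    refine ((mulVL N).le_opNorm _).trans ?_
    gcongr
    exact hdict x y
  · rw [hv]
    refine (norm_add_le _ _).trans ?_
    gcongr
    refine ((mulVL E).le_opNorm _).trans ?_
    gcongr
    exact hdδ t
  · obtain ⟨c, hc, l, hl, g, hg, h⟩ := exists_isIncrementallyStable (H := mulVL P⁻¹)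
      (inner_mulVL_inv_comm hP) (m := (‖mulVL P‖ + 1)⁻¹) (by positivity)
      (norm_sq_le_inner_mulVL_inv hP) (β := α / (2 * (‖mulVL P‖ + 1)))
      (div_pos hSDP.alpha_pos (by positivity))
    -- Adding `w t` does not change differences of the field, so the constants do not depend on `w`.
    refine ⟨c, hc, l, hl, g, hg, fun w => h _ fun t x y => ?_⟩
    rw [add_sub_add_right_eq_sub, hv, hv, add_sub_add_right_eq_sub]
    exact hdis x y

end DataControl

theorem corollary3
    {n m r q τ T : ℕ} (hT : 0 < T)
    -- the plant `ẋ = f(x) + B u + E d` with `f = A Z`, `Z(x) = [x; Q(x)]` continuously differentiable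
    (f : Vec (Fin n) → Vec (Fin n))
    (A : Matrix (Fin n) (Fin n ⊕ Fin r) ℝ) (B : Matrix (Fin n) (Fin m) ℝ)
    (E : Matrix (Fin n) (Fin q) ℝ)
    (Q : Vec (Fin n) → Vec (Fin r)) (hQ : ContDiff ℝ 1 Q)
    (hf : ∀ x, f x = mulV A (dict Q x))
    -- the bound on the Jacobian of `Q` on all of `ℝⁿ`
    (R : Matrix (Fin n) (Fin τ) ℝ)
    (hR : ∀ x, (R * Rᵀ - (jacobian Q x)ᵀ * jacobian Q x).PosSemidef)
    -- the data, with disturbance samples of norm at most `δ`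
    (δ : ℝ) (hδ : 0 < δ)
    (e : Experiment f B E T) (he : ∀ i, ‖e.disturbance (e.time i)‖ ≤ δ)
    -- a solution of the semidefinite program with `Δ = δ √T I`
    (P : Matrix (Fin n) (Fin n) ℝ) (Y₁ : Matrix (Fin T) (Fin n) ℝ)
    (G₂ : Matrix (Fin T) (Fin r) ℝ) (α μ : ℝ)
    (hSDP : IsFeasible e.X1 (e.Z0 Q) E ((δ * √(T : ℝ)) • (1 : Matrix (Fin q) (Fin q) ℝ)) R
      P Y₁ G₂ α μ)
    (K : Matrix (Fin m) (Fin n ⊕ Fin r) ℝ) (hK : K = gain e.U0 P Y₁ G₂)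
    -- the disturbance that acts on the closed loop
    (d : ℝ → Vec (Fin q)) (hd : Continuous d) (hdδ : ∀ t, ‖d t‖ ≤ δ) :
    IsConvergent (closedLoop A B E Q K d) ∧
    ∀ xs : ℝ → Vec (Fin n), IsBoundedSolution (closedLoop A B E Q K d) xs →
      (∀ θ : ℝ, 0 < θ → Function.Periodic d θ → Function.Periodic xs θ) ∧
      ((∃ d₀, ∀ t, d t = d₀) → ∃ x₀, ∀ t, xs t = x₀) ∧
      ∃ (βhat : ℝ → ℝ → ℝ) (γhat : ℝ → ℝ), IsClassKL βhat ∧ IsClassKInfty γhat ∧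
        ∀ w : ℝ → Vec (Fin n), ContinuousOn w (Ici 0) → (∃ C : ℝ, ∀ t, 0 ≤ t → ‖w t‖ ≤ C) →
          ForwardCompleteFrom (fun t x => closedLoop A B E Q K d t x + w t) 0 ∧
          ∀ x : ℝ → Vec (Fin n),
            IsIntegralCurveOn x (fun t x => closedLoop A B E Q K d t x + w t) (Ici 0) →
            ∀ t : ℝ, 0 ≤ t →
              ‖x t - xs t‖ ≤ βhat ‖x 0 - xs 0‖ t +
                γhat (sSup ((fun σ => ‖w σ‖) '' Icc 0 t)) := by
  subst hK
  obtain ⟨hv, ⟨C, hC, hlip⟩, ⟨M, hM⟩, c, hc, l, hl, g, hg, hstab⟩ :=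
    closedLoop_properties (hQ.differentiable one_ne_zero) hf hR e he hSDP hd hdδ
  have hstab0 : IsIncrementallyStable (closedLoop A B E Q (gain e.U0 P Y₁ G₂) d) c l g := by
    simpa using hstab 0
  refine ⟨isConvergent_of_isIncrementallyStable hc hl hg.le hstab0 hv hC hlip hM,
    fun xs hxs => ⟨fun θ _ hθ => hxs.periodic hl hstab0 fun t x => ?_, ?_, ?_⟩⟩
  · simp only [closedLoop, hθ t]
  · rintro ⟨d₀, hd₀⟩
    refine ⟨xs 0, fun t => ?_⟩
    -- For constant `d` every real number `t` is a period, of either sign.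
    have h := hxs.periodic hl hstab0 (θ := t) fun s x => by simp only [closedLoop, hd₀]
    simpa using h 0
  · exact ⟨_, _, isClassKL_mul_exp hc hl, isClassKInfty_const_mul hg, fun w hw hwb =>
      ⟨forwardCompleteFrom_add hv hC hlip hM (hstab w) hw hwb,
        fun x hx t ht => norm_sub_le_of_input hstab0 hxs.1 hwb hx ht⟩⟩
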